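/- **Proposition (Upper bound of sGS-CD).** Let $n \ge 1$, $A \in \mathbb{R}^{n\times n}$, $b \in \mathcal{R}(A)$, $Q = A^TA$ with $Q_{ii} \neq 0$ for all $i$, and consider minimizing $f(x) = \frac12\|Ax-b\|^2$ over $x \in \mathbb{R}^n$, with minimum value $f^*$. The matrix $Q$ may be singular. Let $L = \lambda_{\max}(Q)$ be the largest and $\lambda_{\min}(Q)$ the smallest nonzero eigenvalue of $Q$, $\kappa = \lambda_{\max}(Q)/\lambda_{\min}(Q)$, $L_{\min} = \min_i Q_{ii}$ and $L_{\mathrm{avg}} = \frac1n\sum_{i=1}^n Q_{ii}$. One epoch of sGS-CD (symmetric Gauss–Seidel coordinate descent) goes from $x^k$ to $x^{k+1}$ as follows. The forward pass starts at $x^k$ and minimizes $f$ exactly over one coordinate at a time, with the current values of the other coordinates, in the order $1,2,\dots,n$; its result is $x^{k+1/2}$. The backward pass starts at $x^{k+1/2}$ and does the same in the order $n-1,\dots,1$; its result is $x^{k+1}$. Put $$\rho = \min\left\{1-\frac{1}{n\kappa}\frac{L_{\min}}{L_{\mathrm{avg}}},\; 1-\frac{L_{\min}}{L\,(2+\frac{\log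 n}{\pi})^2}\,\frac1\kappa\right\}.$$ Then for every starting point $x^0 \in \mathbb{R}^n$ and every $k \ge 0$, $$f(x^{k+1/2})-f^* \le \rho\,\bigl(f(x^k)-f^*\bigr),\qquad f(x^{k+1})-f^* \le \rho\,\bigl(f(x^{k+1/2})-f^*\bigr),$$ and $$f(x^{k+1})-f^* \le \rho^2\,\bigl(f(x^k)-f^*\bigr).$$ -/

import Mathlib

noncomputable section

namespace SGSCD

open Matrix

/-- The least squares objective `f(x) = (1/2) ‖A x - b‖²`, with the Euclidean norm. -/
def leastSquares {n : ℕ} (A : Matrix (Fin n) (Fin n) ℝ) (b : Fin n → ℝ) (x : Fin n → ℝ) : ℝ :=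
  (1 / 2) * ‖WithLp.toLp 2 (A *ᵥ x - b)‖ ^ 2

/-- `f^*`, the minimum value of `f`. -/
def minValue {n : ℕ} (f : (Fin n → ℝ) → ℝ) : ℝ := ⨅ z, f z

/-- One coordinate descent iteration: `y` is obtained from `x` by replacing the `i`-th coordinate
by an element of `argmin_t f(x₁, …, xᵢ₋₁, t, xᵢ₊₁, …, xₙ)`. -/
def CoordStep {n : ℕ} (f : (Fin n → ℝ) → ℝ) (i : Fin n) (x y : Fin n → ℝ) : Prop :=
  ∃ s : ℝ, y = Function.update x i s ∧
    ∀ t : ℝ, f (Function.update x i s) ≤ f (Function.update x i t)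

/-- Coordinate descent iterations performed from `x` to `y` in the order of the given list. -/
def CoordSteps {n : ℕ} (f : (Fin n → ℝ) → ℝ) :
    List (Fin n) → (Fin n → ℝ) → (Fin n → ℝ) → Prop
  | [], x, y => y = x
  | i :: l, x, y => ∃ z, CoordStep f i x z ∧ CoordSteps f l z y

/-- Forward pass: the coordinates are updated in the order `1, 2, …, n`. -/
def ForwardPass {n : ℕ} (f : (Fin n → ℝ) → ℝ) (x y : Fin n → ℝ) : Prop :=
  CoordSteps f (List.finRange n) x y

/-- Backward pass: the last coordinate is kept and the others are updated
in the order `n - 1, …, 1`. -/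
def BackwardPass {n : ℕ} (f : (Fin n → ℝ) → ℝ) (x y : Fin n → ℝ) : Prop :=
  CoordSteps f (List.finRange n).reverse.tail x y

/-- `x k` is the output of sGS-CD on `f` after `k` epochs, started at `x 0`, and `xhalf k` is the
intermediate point `x^{k+1/2}` between the forward and the backward pass of the next epoch. -/
structure IsSGSCD {n : ℕ} (f : (Fin n → ℝ) → ℝ) (x xhalf : ℕ → Fin n → ℝ) : Prop where
  forward : ∀ k, ForwardPass f (x k) (xhalf k)
  backward : ∀ k, BackwardPass f (xhalf k) (x (k + 1))

/-- The maximum eigenvalue of a symmetric matrix. -/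
def lamMax {n : ℕ} (Q : Matrix (Fin n) (Fin n) ℝ) : ℝ := sSup (spectrum ℝ Q)

/-- The minimum nonzero eigenvalue of a positive semidefinite matrix. -/
def lamMin {n : ℕ} (Q : Matrix (Fin n) (Fin n) ℝ) : ℝ := sInf (spectrum ℝ Q \ {0})

/-- The condition number `κ = λ_max / λ_min`, where `λ_min` is the minimum nonzero eigenvalue. -/
def condNumber {n : ℕ} (Q : Matrix (Fin n) (Fin n) ℝ) : ℝ := lamMax Q / lamMin Q

/-- `L_min`, the minimum of the diagonal entries. -/
def diagMin {n : ℕ} (Q : Matrix (Fin n) (Fin n) ℝ) : ℝ := ⨅ i, Q i i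

/-- `L_avg`, the average of the diagonal entries. -/
def diagAvg {n : ℕ} (Q : Matrix (Fin n) (Fin n) ℝ) : ℝ := (∑ i, Q i i) / n

/-- `min {1 - L_min / (n κ L_avg), 1 - L_min / (L (2 + log n / π)² κ)}`, with `L = λ_max`. -/
def rate {n : ℕ} (Q : Matrix (Fin n) (Fin n) ℝ) : ℝ :=
  min (1 - 1 / (n * condNumber Q) * (diagMin Q / diagAvg Q))
    (1 - diagMin Q / (lamMax Q * (2 + Real.log n / Real.pi) ^ 2) * (1 / condNumber Q))

end SGSCD

end

/-!
Since `b` is in the range of `A`, the minimum value is `0`. Write `Q = Aᵀ A` and let `Γ` be its lower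
(for a forward pass) or upper (for a backward pass) triangular part, diagonal included. The backward
pass skips the last coordinate, but that coordinate is already optimal after the forward pass, so it
counts as a pass over all coordinates (`BackwardPass.coordSteps_reverse`).

Each exact coordinate minimization makes one entry of the gradient vanish. Hence a pass from `x` to
`y` solves `Γ (x - y) = ∇ f x` and decreases `f` by `∑ i, Q i i * (x i - y i) ^ 2 / 2`, which is at
least `L_min ‖x - y‖ ^ 2 / 2` (`coordSteps_spec`). If `‖Γ v‖ ^ 2 ≤ K ‖v‖ ^ 2` for all `v`, then
`‖x - y‖ ^ 2 ≥ ‖∇ f x‖ ^ 2 / K`, and `‖∇ f x‖ ^ 2 ≥ 2 λ_min f x` by diagonalization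
(`lamMin_mul_quadratic_le`). So the pass contracts `f` by `1 - λ_min L_min / K`. The two terms of the
rate come from two values of `K`.

* `K = λ_max * trace Q` (`triPart_mulVec_sq_le_trace`): the `i`-th entry of `Γ v` is the inner
  product of the `i`-th column of `A` with `A w`, where `w` is `v` with some entries set to zero.
* `K = (λ_max (2 + log n / π)) ^ 2` (`triPart_mulVec_sq_le_log`), a bound for triangular truncation:
  `2 Γ` is the sum of `Q`, its diagonal and `±` the matrix with entries `sign (i - j) * Q i j`. For
  `|k| < n` the discrete Fourier expansion of a square wave (`sum_cot_mul_sin`) gives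
  `n * sign k = ∑ r < n, cot (θ r) * sin (2 * θ r * k)` with `θ r = (2 r + 1) π / (2 n)`. Multiplying
  the entries of `Q` by `sin (α i - α j)` does not increase its norm, so the norm of the third matrix
  is at most `λ_max / n * ∑ r, |cot (θ r)|`, hence at most `λ_max (2 + 2 log n / π)`.

Norms are avoided: a bound `|u ⬝ᵥ M v| ≤ K ‖u‖ ‖v‖` is used in the equivalent form
`|u ⬝ᵥ M v| ≤ K / 2 * (u ⬝ᵥ u + v ⬝ᵥ v)`.
-/

namespace SGSCD

open Matrix

/-! ### The Fourier expansion of the sign function -/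

/-- Multiplied by `2 sin (k π / n)`, the sum telescopes. -/
theorem sum_cos_odd_eq_zero {n k : ℕ} (hk : 0 < k) (hkn : k < n) :
    ∑ r ∈ Finset.range n, Real.cos (k * (Real.pi * (2 * r + 1) / n)) = 0 := by
  have hn : (0 : ℝ) < n := by exact_mod_cast hk.trans hkn
  have hk' : (0 : ℝ) < k := by exact_mod_cast hk
  have hkn' : (k : ℝ) < n := by exact_mod_cast hkn
  have hs : 0 < Real.sin (k * Real.pi / n) := by
    apply Real.sin_pos_of_pos_of_lt_pi
    · positivity
    · rw [div_lt_iff₀ hn]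
      nlinarith [Real.pi_pos]
  have key : ∀ r : ℕ, 2 * Real.sin (k * Real.pi / n) *
      Real.cos (k * (Real.pi * (2 * r + 1) / n)) =
      Real.sin (k * (2 * Real.pi * ((r + 1 : ℕ) : ℝ) / n)) -
        Real.sin (k * (2 * Real.pi * (r : ℝ) / n)) := by
    intro r
    rw [show (k * (2 * Real.pi * ((r + 1 : ℕ) : ℝ) / n) : ℝ) =
        k * (Real.pi * (2 * r + 1) / n) + k * Real.pi / n by push_cast; ring,
      show (k * (2 * Real.pi * (r : ℝ) / n) : ℝ) =
        k * (Real.pi * (2 * r + 1) / n) - k * Real.pi / n by ring,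
      Real.sin_add, Real.sin_sub]
    ring
  have h : 2 * Real.sin (k * Real.pi / n) *
      ∑ r ∈ Finset.range n, Real.cos (k * (Real.pi * (2 * r + 1) / n)) = 0 := by
    rw [Finset.mul_sum, Finset.sum_congr rfl fun r _ => key r, Finset.sum_range_sub
      (fun r : ℕ => Real.sin (k * (2 * Real.pi * (r : ℝ) / n)))]
    rw [show (k * (2 * Real.pi * (n : ℝ) / n) : ℝ) = ((2 * k : ℕ) : ℝ) * Real.pi by
      push_cast; field_simp]
    rw [Real.sin_nat_mul_pi]
    simp
  exact (mul_eq_zero.mp h).resolve_left (by positivity)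

/-- The angle `(2 r + 1) π / (2 n)`; the doubled angles are the odd frequencies in the Fourier
expansion of the `2 n`-periodic square wave. -/
noncomputable def node (n r : ℕ) : ℝ := Real.pi * (2 * r + 1) / (2 * n)

theorem node_pos {n : ℕ} (hn : 0 < n) (r : ℕ) : 0 < node n r := by
  unfold node
  have := Real.pi_pos
  positivity

theorem node_lt_pi {n r : ℕ} (hr : r < n) : node n r < Real.pi := by
  have hn : (0 : ℝ) < n := by exact_mod_cast (Nat.zero_le r).trans_lt hr
  have hr' : (r : ℝ) + 1 ≤ n := by exact_mod_cast hr
  unfold node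
  rw [div_lt_iff₀ (by positivity)]
  nlinarith [Real.pi_pos]

/-- The Fourier expansion of the sign function on `(-n, n)`, at a positive argument. The difference
of the sums at `k + 1` and `k` is a sum of cosines that vanishes for `0 < k < n - 1` and equals `n`
for `k = 0`. -/
theorem sum_cot_mul_sin {n k : ℕ} (hk : 0 < k) (hkn : k < n) :
    ∑ r ∈ Finset.range n, Real.cot (node n r) * Real.sin (2 * node n r * k) = n := by
  have hn : (0 : ℝ) < n := by exact_mod_cast hk.trans hkn
  have hcos : ∀ (m r : ℕ), Real.cos (2 * node n r * m) =
      Real.cos (m * (Real.pi * (2 * r + 1) / n)) := by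
    intro m r
    congr 1
    unfold node
    field_simp
  have key : ∀ m r : ℕ, r < n → Real.cot (node n r) * Real.sin (2 * node n r * (m + 1 : ℕ)) =
      Real.cot (node n r) * Real.sin (2 * node n r * m) +
        (Real.cos (2 * node n r * (m + 1 : ℕ)) + Real.cos (2 * node n r * m)) := by
    intro m r hr
    have hs : Real.sin (node n r) ≠ 0 :=
      (Real.sin_pos_of_pos_of_lt_pi (node_pos (hk.trans hkn) r) (node_lt_pi hr)).ne'
    rw [Real.cot_eq_cos_div_sin,
      show 2 * node n r * (m + 1 : ℕ) = 2 * node n r * m + 2 * node n r by push_cast; ring,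
      Real.sin_add, Real.cos_add, Real.sin_two_mul, Real.cos_two_mul]
    field_simp
    have := Real.sin_sq_add_cos_sq (node n r)
    linear_combination (2 * Real.cos (node n r) * Real.sin (2 * node n r * m)) * this
  have step : ∀ m : ℕ, ∑ r ∈ Finset.range n,
      Real.cot (node n r) * Real.sin (2 * node n r * (m + 1 : ℕ)) =
      ∑ r ∈ Finset.range n, Real.cot (node n r) * Real.sin (2 * node n r * m) +
        (∑ r ∈ Finset.range n, Real.cos (2 * node n r * (m + 1 : ℕ)) +
          ∑ r ∈ Finset.range n, Real.cos (2 * node n r * m)) := by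
    intro m
    rw [← Finset.sum_add_distrib, ← Finset.sum_add_distrib]
    exact Finset.sum_congr rfl fun r hr => key m r (Finset.mem_range.mp hr)
  have hzero : ∀ m : ℕ, 0 < m → m < n → ∑ r ∈ Finset.range n, Real.cos (2 * node n r * m) = 0 := by
    intro m h0 h1
    rw [← sum_cos_odd_eq_zero h0 h1]
    exact Finset.sum_congr rfl fun r _ => hcos m r
  induction k with
  | zero => omega
  | succ k ih =>
    rw [step k, hzero (k + 1) hk hkn]
    rcases Nat.eq_zero_or_pos k with rfl | h
    · simp
    · rw [ih h (by omega), hzero k h (by omega)]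
      ring

theorem sum_inv_odd_le_one_add_log (m : ℕ) :
    ∑ r ∈ Finset.range (m + 1), (1 : ℝ) / (2 * r + 1) ≤ 1 + Real.log (2 * m + 1) / 2 := by
  induction m with
  | zero => simp
  | succ m ih =>
    rw [Finset.sum_range_succ]
    have h1 : (0 : ℝ) < 2 * m + 1 := by positivity
    have h2 : (0 : ℝ) < 2 * m + 3 := by positivity
    have h := Real.one_sub_inv_le_log_of_pos (div_pos h2 h1)
    rw [Real.log_div h2.ne' h1.ne'] at h
    have e : 1 - ((2 * (m : ℝ) + 3) / (2 * m + 1))⁻¹ = 2 * (1 / (2 * m + 3)) := by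
      field_simp
      ring
    rw [e] at h
    push_cast
    rw [show (2 * ((m : ℝ) + 1) + 1) = 2 * m + 3 by ring]
    linarith

theorem cot_le_inv {x : ℝ} (h0 : 0 < x) (h1 : x ≤ Real.pi / 2) : Real.cot x ≤ 1 / x := by
  rcases h1.eq_or_lt with rfl | h1
  · rw [Real.cot_eq_cos_div_sin]
    simp
    positivity
  · rw [← Real.tan_inv_eq_cot, one_div]
    exact inv_anti₀ h0 (Real.lt_tan h0 h1).le

/-- The nodes are symmetric about `π / 2`, so the sum is at most twice the part with
`2 r + 1 ≤ n`, where `cot x ≤ 1 / x` turns it into a sum of reciprocals of odd numbers. -/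
theorem sum_abs_cot_le {n : ℕ} (hn : 0 < n) :
    ∑ r ∈ Finset.range n, |Real.cot (node n r)| ≤ n * (2 + 2 * (Real.log n / Real.pi)) := by
  have hn' : (0 : ℝ) < n := by exact_mod_cast hn
  have hpi := Real.pi_pos
  let g : ℕ → ℝ := fun r => if 2 * r + 1 ≤ n then 2 * n / Real.pi * (1 / (2 * r + 1)) else 0
  have hg0 : ∀ r, 0 ≤ g r := by
    intro r
    simp only [g]
    split_ifs
    · positivity
    · exact le_rfl
  have hcot : ∀ r, 2 * r + 1 ≤ n → |Real.cot (node n r)| ≤ g r := by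
    intro r hr
    have hr' : (2 * r + 1 : ℝ) ≤ n := by exact_mod_cast hr
    have hle : node n r ≤ Real.pi / 2 := by
      unfold node
      rw [div_le_div_iff₀ (by positivity) (by positivity)]
      nlinarith
    have hnn : 0 ≤ Real.cot (node n r) := by
      rw [Real.cot_eq_cos_div_sin]
      exact div_nonneg (Real.cos_nonneg_of_mem_Icc ⟨by linarith [node_pos hn r], hle⟩)
        (Real.sin_nonneg_of_nonneg_of_le_pi (node_pos hn r).le (by linarith))
    rw [abs_of_nonneg hnn]
    simp only [g, hr, if_true]
    refine (cot_le_inv (node_pos hn r) hle).trans_eq ?_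
    unfold node
    field_simp
  have hbound : ∀ r ∈ Finset.range n, |Real.cot (node n r)| ≤ g r + g (n - 1 - r) := by
    intro r hr
    have hr := Finset.mem_range.mp hr
    by_cases h : 2 * r + 1 ≤ n
    · linarith [hcot r h, hg0 (n - 1 - r)]
    · have h1 := hcot (n - 1 - r) (by omega)
      have h2 : node n (n - 1 - r) = Real.pi - node n r := by
        unfold node
        rw [Nat.sub_sub, Nat.cast_sub (by omega)]
        field_simp
        push_cast
        ring
      have h3 : |Real.cot (Real.pi - node n r)| = |Real.cot (node n r)| := by
        rw [Real.cot_eq_cos_div_sin, Real.cot_eq_cos_div_sin, Real.cos_pi_sub, Real.sin_pi_sub,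
          neg_div, abs_neg]
      rw [h2, h3] at h1
      linarith [hg0 r]
  -- The `r` with `2 r + 1 ≤ n` are those below `(n - 1) / 2 + 1`, with division in `ℕ`.
  have hsum : ∑ r ∈ Finset.range n, g r ≤ 2 * n / Real.pi * (1 + Real.log n / 2) := by
    have e : ∑ r ∈ Finset.range n, g r =
        2 * n / Real.pi * ∑ r ∈ Finset.range ((n - 1) / 2 + 1), (1 : ℝ) / (2 * r + 1) := by
      rw [Finset.mul_sum, ← Finset.sum_filter]
      refine Finset.sum_congr ?_ fun _ _ => rfl
      ext r
      simp only [Finset.mem_filter, Finset.mem_range]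
      omega
    rw [e]
    refine mul_le_mul_of_nonneg_left ((sum_inv_odd_le_one_add_log _).trans ?_) (by positivity)
    have h : (2 * ((n - 1) / 2 : ℕ) + 1 : ℝ) ≤ n := by
      have : 2 * ((n - 1) / 2) + 1 ≤ n := by omega
      exact_mod_cast this
    have := Real.log_le_log (by positivity) h
    linarith
  calc ∑ r ∈ Finset.range n, |Real.cot (node n r)|
      ≤ ∑ r ∈ Finset.range n, (g r + g (n - 1 - r)) := Finset.sum_le_sum hbound
    _ = 2 * ∑ r ∈ Finset.range n, g r := by
      rw [Finset.sum_add_distrib, Finset.sum_range_reflect]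
      ring
    _ ≤ 2 * (2 * n / Real.pi * (1 + Real.log n / 2)) := by linarith
    _ = n * (4 / Real.pi + 2 * (Real.log n / Real.pi)) := by
      field_simp
      ring
    _ ≤ n * (2 + 2 * (Real.log n / Real.pi)) := by
      have : 4 / Real.pi ≤ 2 := by
        rw [div_le_iff₀ hpi]
        linarith [Real.pi_gt_three]
      gcongr

variable {n : ℕ}

/-! ### Extreme eigenvalues -/

/-- The witness `c` is the vector of coordinates of `e` in an orthonormal eigenbasis of `Q`. -/
theorem exists_orthogonal_diagonalization {Q : Matrix (Fin n) (Fin n) ℝ} (hQ : Q.IsHermitian)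
    (e : Fin n → ℝ) : ∃ c : Fin n → ℝ,
      e ⬝ᵥ e = ∑ i, c i ^ 2 ∧
      e ⬝ᵥ (Q *ᵥ e) = ∑ i, hQ.eigenvalues i * c i ^ 2 ∧
      (Q *ᵥ e) ⬝ᵥ (Q *ᵥ e) = ∑ i, hQ.eigenvalues i ^ 2 * c i ^ 2 := by
  set U : Matrix (Fin n) (Fin n) ℝ := (hQ.eigenvectorUnitary : Matrix (Fin n) (Fin n) ℝ)
  have h1 : Uᵀ * U = 1 := Matrix.mem_unitaryGroup_iff'.mp hQ.eigenvectorUnitary.2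
  have h2 : U * Uᵀ = 1 := Matrix.mem_unitaryGroup_iff.mp hQ.eigenvectorUnitary.2
  have hs : Q = U * diagonal hQ.eigenvalues * Uᵀ := by
    conv_lhs => rw [hQ.spectral_theorem, Unitary.conjStarAlgAut_apply]
    rfl
  have hdot : ∀ v w, (U *ᵥ v) ⬝ᵥ (U *ᵥ w) = v ⬝ᵥ w := by
    intro v w
    rw [dotProduct_mulVec, ← mulVec_transpose, mulVec_mulVec, h1, one_mulVec]
  have he : e = U *ᵥ (Uᵀ *ᵥ e) := by rw [mulVec_mulVec, h2, one_mulVec]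
  have hQe : Q *ᵥ e = U *ᵥ (diagonal hQ.eigenvalues *ᵥ (Uᵀ *ᵥ e)) := by
    rw [mulVec_mulVec, mulVec_mulVec, ← hs]
  refine ⟨Uᵀ *ᵥ e, ?_, ?_, ?_⟩
  · conv_lhs => rw [he, hdot]
    simp [dotProduct, sq]
  · rw [hQe]
    conv_lhs => rw [he, hdot]
    rw [← he]
    simp only [dotProduct, mulVec_diagonal]
    exact Finset.sum_congr rfl fun i _ => by ring
  · rw [hQe, hdot]
    simp only [dotProduct, mulVec_diagonal]
    exact Finset.sum_congr rfl fun i _ => by ring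

theorem eigenvalues_le_lamMax {Q : Matrix (Fin n) (Fin n) ℝ} (hQ : Q.IsHermitian) (i : Fin n) :
    hQ.eigenvalues i ≤ lamMax Q := by
  unfold lamMax
  rw [hQ.spectrum_real_eq_range_eigenvalues]
  exact le_csSup (Set.finite_range _).bddAbove ⟨i, rfl⟩

theorem lamMin_le_eigenvalues {Q : Matrix (Fin n) (Fin n) ℝ} (hQ : Q.IsHermitian) {i : Fin n}
    (hi : hQ.eigenvalues i ≠ 0) : lamMin Q ≤ hQ.eigenvalues i := by
  unfold lamMin
  rw [hQ.spectrum_real_eq_range_eigenvalues]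
  exact csInf_le ((Set.finite_range _).subset Set.sdiff_subset).bddBelow ⟨⟨i, rfl⟩, hi⟩

theorem lamMin_pos {Q : Matrix (Fin n) (Fin n) ℝ} (hQ : Q.PosSemidef) (h0 : Q ≠ 0) :
    0 < lamMin Q := by
  have hne : (Set.range hQ.1.eigenvalues \ {0}).Nonempty := by
    obtain ⟨i, hi⟩ := Function.ne_iff.mp (mt hQ.1.eigenvalues_eq_zero_iff.mp h0)
    exact ⟨_, ⟨i, rfl⟩, hi⟩
  have h := hne.csInf_mem ((Set.finite_range _).subset Set.sdiff_subset)
  unfold lamMin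
  rw [hQ.1.spectrum_real_eq_range_eigenvalues]
  obtain ⟨⟨i, hi⟩, hi0⟩ := h
  rw [← hi] at hi0 ⊢
  exact lt_of_le_of_ne (hQ.eigenvalues_nonneg i) (Ne.symm hi0)

theorem lamMax_pos {Q : Matrix (Fin n) (Fin n) ℝ} (hQ : Q.PosSemidef) (h0 : Q ≠ 0) :
    0 < lamMax Q := by
  obtain ⟨i, hi⟩ := Function.ne_iff.mp (mt hQ.1.eigenvalues_eq_zero_iff.mp h0)
  exact (lt_of_le_of_ne (hQ.eigenvalues_nonneg i) (Ne.symm hi)).trans_le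
    (eigenvalues_le_lamMax hQ.1 i)

theorem quadratic_le_lamMax {Q : Matrix (Fin n) (Fin n) ℝ} (hQ : Q.IsHermitian) (e : Fin n → ℝ) :
    e ⬝ᵥ (Q *ᵥ e) ≤ lamMax Q * (e ⬝ᵥ e) := by
  obtain ⟨c, h1, h2, -⟩ := exists_orthogonal_diagonalization hQ e
  rw [h1, h2, Finset.mul_sum]
  exact Finset.sum_le_sum fun i _ =>
    mul_le_mul_of_nonneg_right (eigenvalues_le_lamMax hQ i) (sq_nonneg _)

/-- The Polyak–Łojasiewicz inequality for a possibly singular quadratic form: eigendirections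
with eigenvalue zero contribute to neither side. -/
theorem lamMin_mul_quadratic_le {Q : Matrix (Fin n) (Fin n) ℝ} (hQ : Q.PosSemidef)
    (e : Fin n → ℝ) : lamMin Q * (e ⬝ᵥ (Q *ᵥ e)) ≤ (Q *ᵥ e) ⬝ᵥ (Q *ᵥ e) := by
  obtain ⟨c, -, h2, h3⟩ := exists_orthogonal_diagonalization hQ.1 e
  rw [h2, h3, Finset.mul_sum]
  refine Finset.sum_le_sum fun i _ => ?_
  by_cases hi : hQ.1.eigenvalues i = 0
  · simp [hi]
  · have h := mul_le_mul_of_nonneg_right (lamMin_le_eigenvalues hQ.1 hi)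
      (mul_nonneg (hQ.eigenvalues_nonneg i) (sq_nonneg (c i)))
    linarith

/-! ### Triangular truncation -/

/-- The part of `Q` on and on one side of the diagonal: the entries `Q i j` with `j = i` or
`r j i`. For `r` the order `<` (`>`) it is the lower (upper) triangular part. -/
def triPart (Q : Matrix (Fin n) (Fin n) ℝ) (r : Fin n → Fin n → Prop) [DecidableRel r] :
    Matrix (Fin n) (Fin n) ℝ :=
  of fun i j => if j = i ∨ r j i then Q i j else 0

theorem posSemidef_gram (A : Matrix (Fin n) (Fin n) ℝ) : (Aᵀ * A).PosSemidef :=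
  posSemidef_conjTranspose_mul_self A

theorem quadratic_gram (A : Matrix (Fin n) (Fin n) ℝ) (u v : Fin n → ℝ) :
    u ⬝ᵥ ((Aᵀ * A) *ᵥ v) = (A *ᵥ u) ⬝ᵥ (A *ᵥ v) := by
  rw [← mulVec_mulVec, dotProduct_mulVec, vecMul_transpose]

/-- Each row of `Γ v` is the inner product of a column of `A` with `A w`, where `w` is `v` with some
entries set to zero. -/
theorem triPart_mulVec_sq_le_trace (A : Matrix (Fin n) (Fin n) ℝ) (r : Fin n → Fin n → Prop)
    [DecidableRel r] (v : Fin n → ℝ) :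
    (triPart (Aᵀ * A) r *ᵥ v) ⬝ᵥ (triPart (Aᵀ * A) r *ᵥ v) ≤
      lamMax (Aᵀ * A) * (∑ i, (Aᵀ * A) i i) * (v ⬝ᵥ v) := by
  have hQ := (posSemidef_gram A).1
  have hL : ∀ w, (A *ᵥ w) ⬝ᵥ (A *ᵥ w) ≤ lamMax (Aᵀ * A) * (w ⬝ᵥ w) := fun w => by
    rw [← quadratic_gram]; exact quadratic_le_lamMax hQ w
  have key : ∀ i, (triPart (Aᵀ * A) r *ᵥ v) i * (triPart (Aᵀ * A) r *ᵥ v) i ≤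
      (Aᵀ * A) i i * (lamMax (Aᵀ * A) * (v ⬝ᵥ v)) := by
    intro i
    set w : Fin n → ℝ := fun j => if j = i ∨ r j i then v j else 0 with hw
    have e1 : (triPart (Aᵀ * A) r *ᵥ v) i = ∑ l, A l i * (A *ᵥ w) l := by
      have : (triPart (Aᵀ * A) r *ᵥ v) i = ((Aᵀ * A) *ᵥ w) i := by
        simp only [mulVec, dotProduct, triPart, of_apply, hw]
        exact Finset.sum_congr rfl fun j _ => by split_ifs <;> simp
      rw [this, ← mulVec_mulVec]
      rfl
    have e2 : (Aᵀ * A) i i = ∑ l, A l i ^ 2 := by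
      simp [Matrix.mul_apply, sq]
    have e3 : w ⬝ᵥ w ≤ v ⬝ᵥ v := by
      refine Finset.sum_le_sum fun j _ => ?_
      simp only [hw]
      split_ifs
      · exact le_rfl
      · nlinarith [mul_self_nonneg (v j)]
    have hL0 : 0 ≤ lamMax (Aᵀ * A) := by
      rcases eq_or_ne (Aᵀ * A) 0 with h0 | h0
      · have h := eigenvalues_le_lamMax hQ i
        rw [hQ.eigenvalues_eq_zero_iff.mpr h0] at h
        exact h
      · exact (lamMax_pos (posSemidef_gram A) h0).le
    have e4 := hL w
    calc _ = (∑ l, A l i * (A *ᵥ w) l) ^ 2 := by rw [e1, sq]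
      _ ≤ (∑ l, A l i ^ 2) * ∑ l, (A *ᵥ w) l ^ 2 := Finset.sum_mul_sq_le_sq_mul_sq _ _ _
      _ ≤ (Aᵀ * A) i i * (lamMax (Aᵀ * A) * (v ⬝ᵥ v)) := by
        rw [e2]
        refine mul_le_mul_of_nonneg_left ?_ (Finset.sum_nonneg fun _ _ => sq_nonneg _)
        have : ∑ l, (A *ᵥ w) l ^ 2 = (A *ᵥ w) ⬝ᵥ (A *ᵥ w) := by simp [dotProduct, sq]
        rw [this]
        exact e4.trans (mul_le_mul_of_nonneg_left e3 hL0)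
  refine (Finset.sum_le_sum fun i _ => key i).trans_eq ?_
  rw [← Finset.sum_mul]
  ring

theorem abs_gram_le (A : Matrix (Fin n) (Fin n) ℝ) (u v : Fin n → ℝ) :
    |(A *ᵥ u) ⬝ᵥ (A *ᵥ v)| ≤ lamMax (Aᵀ * A) / 2 * (u ⬝ᵥ u + v ⬝ᵥ v) := by
  have hL : ∀ w, (A *ᵥ w) ⬝ᵥ (A *ᵥ w) ≤ lamMax (Aᵀ * A) * (w ⬝ᵥ w) := fun w => by
    rw [← quadratic_gram]; exact quadratic_le_lamMax (posSemidef_gram A).1 w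
  have h1 : 0 ≤ (A *ᵥ u - A *ᵥ v) ⬝ᵥ (A *ᵥ u - A *ᵥ v) :=
    Finset.sum_nonneg fun _ _ => mul_self_nonneg _
  have h2 : 0 ≤ (A *ᵥ u + A *ᵥ v) ⬝ᵥ (A *ᵥ u + A *ᵥ v) :=
    Finset.sum_nonneg fun _ _ => mul_self_nonneg _
  simp only [sub_dotProduct, dotProduct_sub, add_dotProduct, dotProduct_add] at h1 h2
  rw [dotProduct_comm (A *ᵥ v) (A *ᵥ u)] at h1 h2
  rw [abs_le]
  constructor <;> linarith [hL u, hL v]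

/-- The sign of `i - j`. -/
def sgn (i j : Fin n) : ℝ := if j < i then 1 else if i < j then -1 else 0

theorem sum_cot_mul_sin_sub (i j : Fin n) :
    ∑ r ∈ Finset.range n, Real.cot (node n r) * Real.sin (2 * node n r * i - 2 * node n r * j) =
      n * sgn i j := by
  unfold sgn
  rcases lt_trichotomy j i with h | h | h
  · have e := sum_cot_mul_sin (n := n) (k := i - j) (by have : (j : ℕ) < i := h; omega)
      (by have := i.2; omega)
    rw [if_pos h, mul_one]
    refine Eq.trans (Finset.sum_congr rfl fun r _ => ?_) e
    rw [Nat.cast_sub (by exact_mod_cast h.le)]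
    ring_nf
  · subst h
    simp
  · have e := sum_cot_mul_sin (n := n) (k := j - i) (by have : (i : ℕ) < j := h; omega)
      (by have := j.2; omega)
    rw [if_neg h.asymm, if_pos h, mul_neg, mul_one, ← e, ← Finset.sum_neg_distrib]
    refine Finset.sum_congr rfl fun r _ => ?_
    rw [Nat.cast_sub (by exact_mod_cast h.le), ← mul_neg, ← Real.sin_neg]
    ring_nf

/-- Expanding the sine by the addition theorem writes the form as a difference of two values of
the bilinear form of `Q`, at vectors scaled by `sin (α i)` and `cos (α i)`; the four squared norms
of these vectors add up to those of `u` and `v`. -/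
theorem abs_sin_sub_form_le (A : Matrix (Fin n) (Fin n) ℝ) (α : ℝ) (u v : Fin n → ℝ) :
    |∑ i : Fin n, ∑ j : Fin n, Real.sin (α * i - α * j) * ((Aᵀ * A) i j * u i * v j)| ≤
      lamMax (Aᵀ * A) / 2 * (u ⬝ᵥ u + v ⬝ᵥ v) := by
  let s : (Fin n → ℝ) → Fin n → ℝ := fun w i => Real.sin (α * i) * w i
  let c : (Fin n → ℝ) → Fin n → ℝ := fun w i => Real.cos (α * i) * w i
  have e : ∑ i : Fin n, ∑ j : Fin n, Real.sin (α * i - α * j) * ((Aᵀ * A) i j * u i * v j) =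
      (A *ᵥ s u) ⬝ᵥ (A *ᵥ c v) - (A *ᵥ c u) ⬝ᵥ (A *ᵥ s v) := by
    rw [← quadratic_gram, ← quadratic_gram]
    simp only [dotProduct, mulVec, Finset.mul_sum, ← Finset.sum_sub_distrib, s, c]
    refine Finset.sum_congr rfl fun i _ => Finset.sum_congr rfl fun j _ => ?_
    rw [Real.sin_sub]
    ring
  have hsc : ∀ w : Fin n → ℝ, s w ⬝ᵥ s w + c w ⬝ᵥ c w = w ⬝ᵥ w := by
    intro w
    simp only [dotProduct, ← Finset.sum_add_distrib, s, c]
    refine Finset.sum_congr rfl fun i _ => ?_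
    linear_combination (w i * w i) * Real.sin_sq_add_cos_sq (α * i)
  rw [e, ← hsc u, ← hsc v]
  have h1 := abs_gram_le A (s u) (c v)
  have h2 := abs_gram_le A (c u) (s v)
  refine (abs_sub _ _).trans ((add_le_add h1 h2).trans_eq ?_)
  ring

/-- The skew-symmetric matrix with entries `sgn i j * Q i j` is a linear combination of matrices
with entries `sin (α i - α j) * Q i j`, with cotangents as coefficients. -/
theorem abs_sgn_form_le (hn : 0 < n) (A : Matrix (Fin n) (Fin n) ℝ) (u v : Fin n → ℝ) :
    |∑ i, ∑ j, sgn i j * ((Aᵀ * A) i j * u i * v j)| ≤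
      (2 + 2 * (Real.log n / Real.pi)) * (lamMax (Aᵀ * A) / 2 * (u ⬝ᵥ u + v ⬝ᵥ v)) := by
  have hn' : (0 : ℝ) < n := by exact_mod_cast hn
  set K := lamMax (Aᵀ * A) / 2 * (u ⬝ᵥ u + v ⬝ᵥ v) with hK
  have hK0 : 0 ≤ K := (abs_nonneg _).trans (abs_gram_le A u v)
  have e : n * ∑ i, ∑ j, sgn i j * ((Aᵀ * A) i j * u i * v j) =
      ∑ r ∈ Finset.range n, Real.cot (node n r) *
        ∑ i : Fin n, ∑ j : Fin n, Real.sin (2 * node n r * i - 2 * node n r * j) *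
          ((Aᵀ * A) i j * u i * v j) := by
    simp only [Finset.mul_sum]
    rw [Finset.sum_comm (s := Finset.range n)]
    refine Finset.sum_congr rfl fun i _ => ?_
    rw [Finset.sum_comm (s := Finset.range n)]
    refine Finset.sum_congr rfl fun j _ => ?_
    rw [← mul_assoc, ← sum_cot_mul_sin_sub, Finset.sum_mul]
    exact Finset.sum_congr rfl fun r _ => by ring
  refine le_of_mul_le_mul_left ?_ hn'
  calc n * |∑ i, ∑ j, sgn i j * ((Aᵀ * A) i j * u i * v j)|
      = |n * ∑ i, ∑ j, sgn i j * ((Aᵀ * A) i j * u i * v j)| := by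
        rw [abs_mul, abs_of_pos hn']
    _ ≤ ∑ r ∈ Finset.range n, |Real.cot (node n r)| * K := by
        rw [e]
        refine (Finset.abs_sum_le_sum_abs _ _).trans (Finset.sum_le_sum fun r _ => ?_)
        rw [abs_mul]
        exact mul_le_mul_of_nonneg_left (abs_sin_sub_form_le A _ u v) (abs_nonneg _)
    _ ≤ n * (2 + 2 * (Real.log n / Real.pi)) * K := by
        rw [← Finset.sum_mul]
        exact mul_le_mul_of_nonneg_right (sum_abs_cot_le hn) hK0
    _ = n * ((2 + 2 * (Real.log n / Real.pi)) * K) := by ring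

theorem sum_diag_mul_le (A : Matrix (Fin n) (Fin n) ℝ) (u v : Fin n → ℝ) :
    ∑ i, (Aᵀ * A) i i * u i * v i ≤ lamMax (Aᵀ * A) / 2 * (u ⬝ᵥ u + v ⬝ᵥ v) := by
  simp only [dotProduct, ← Finset.sum_add_distrib, Finset.mul_sum]
  refine Finset.sum_le_sum fun i _ => ?_
  have h0 := (posSemidef_gram A).diag_nonneg (i := i)
  have h1 : (Aᵀ * A) i i ≤ lamMax (Aᵀ * A) := by
    have := quadratic_le_lamMax (posSemidef_gram A).1 (Pi.single i 1)
    simpa using this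
  have h2 := mul_le_mul_of_nonneg_right h1
    (add_nonneg (mul_self_nonneg (u i)) (mul_self_nonneg (v i)))
  have h3 := mul_nonneg h0 (mul_self_nonneg (u i - v i))
  linarith

/-- The triangular part is half the sum of `Q`, its diagonal and, up to sign, the matrix with entries
`sgn i j * Q i j`. -/
theorem triPart_form_le (hn : 0 < n) (A : Matrix (Fin n) (Fin n) ℝ) (r : Fin n → Fin n → Prop)
    [DecidableRel r] (hr : (∀ i j, r i j ↔ i < j) ∨ (∀ i j, r i j ↔ j < i)) (u v : Fin n → ℝ) :
    u ⬝ᵥ (triPart (Aᵀ * A) r *ᵥ v) ≤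
      lamMax (Aᵀ * A) * (2 + Real.log n / Real.pi) / 2 * (u ⬝ᵥ u + v ⬝ᵥ v) := by
  obtain ⟨σ, hσ, h⟩ : ∃ σ : ℝ, |σ| = 1 ∧ ∀ i j, triPart (Aᵀ * A) r i j =
      1 / 2 * ((Aᵀ * A) i j + (if i = j then (Aᵀ * A) i j else 0) +
        σ * (sgn i j * (Aᵀ * A) i j)) := by
    rcases hr with hr | hr
    · refine ⟨1, by simp, fun i j => ?_⟩
      simp only [triPart, sgn, of_apply, hr]
      rcases lt_trichotomy j i with h | h | h
      · simp [h, h.ne']; ring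
      · simp [h]; ring
      · simp [h, h.ne', h.ne, h.asymm]
    · refine ⟨-1, by simp, fun i j => ?_⟩
      simp only [triPart, sgn, of_apply, hr]
      rcases lt_trichotomy j i with h | h | h
      · simp [h, h.ne', h.ne, h.asymm]
      · simp [h]; ring
      · simp [h, h.ne, h.asymm]; ring
  have e : u ⬝ᵥ (triPart (Aᵀ * A) r *ᵥ v) = 1 / 2 * ((A *ᵥ u) ⬝ᵥ (A *ᵥ v) +
      ∑ i, (Aᵀ * A) i i * u i * v i + σ * ∑ i, ∑ j, sgn i j * ((Aᵀ * A) i j * u i * v j)) := by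
    rw [← quadratic_gram]
    have hd : ∑ i, (Aᵀ * A) i i * u i * v i =
        ∑ i, ∑ j, (if i = j then (Aᵀ * A) i j else 0) * u i * v j := by
      refine Finset.sum_congr rfl fun i _ => ?_
      simp
    rw [hd]
    simp only [dotProduct, mulVec, Finset.mul_sum, ← Finset.sum_add_distrib]
    refine Finset.sum_congr rfl fun i _ => Finset.sum_congr rfl fun j _ => ?_
    rw [h]
    ring
  have h1 := (le_abs_self _).trans (abs_gram_le A u v)
  have h2 := sum_diag_mul_le A u v
  have h3 : σ * ∑ i, ∑ j, sgn i j * ((Aᵀ * A) i j * u i * v j) ≤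
      (2 + 2 * (Real.log n / Real.pi)) * (lamMax (Aᵀ * A) / 2 * (u ⬝ᵥ u + v ⬝ᵥ v)) := by
    refine (le_abs_self _).trans ?_
    rw [abs_mul, hσ, one_mul]
    exact abs_sgn_form_le hn A u v
  rw [e]
  linarith

/-- The norm of the triangular truncation of `Q` exceeds that of `Q` at most by a factor
`2 + log n / π`. -/
theorem triPart_mulVec_sq_le_log (hn : 0 < n) (A : Matrix (Fin n) (Fin n) ℝ)
    (r : Fin n → Fin n → Prop) [DecidableRel r]
    (hr : (∀ i j, r i j ↔ i < j) ∨ (∀ i j, r i j ↔ j < i)) (hL : 0 < lamMax (Aᵀ * A))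
    (v : Fin n → ℝ) :
    (triPart (Aᵀ * A) r *ᵥ v) ⬝ᵥ (triPart (Aᵀ * A) r *ᵥ v) ≤
      (lamMax (Aᵀ * A) * (2 + Real.log n / Real.pi)) ^ 2 * (v ⬝ᵥ v) := by
  have hlog : 0 ≤ Real.log n / Real.pi := div_nonneg (Real.log_natCast_nonneg n) Real.pi_pos.le
  set K := lamMax (Aᵀ * A) * (2 + Real.log n / Real.pi) with hK
  have hK0 : 0 < K := mul_pos hL (by linarith)
  set w := triPart (Aᵀ * A) r *ᵥ v with hw
  -- The bound on the bilinear form at `w / K` and `v`.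
  have h := triPart_form_le hn A r hr (K⁻¹ • w) v
  rw [← hw, ← hK] at h
  simp only [smul_dotProduct, dotProduct_smul, smul_eq_mul] at h
  have h' := mul_le_mul_of_nonneg_left h (by positivity : 0 ≤ 2 * K)
  have e1 : 2 * K * (K⁻¹ * (w ⬝ᵥ w)) = 2 * (w ⬝ᵥ w) := by field_simp
  have e2 : 2 * K * (K / 2 * (K⁻¹ * (K⁻¹ * (w ⬝ᵥ w)) + v ⬝ᵥ v)) =
      w ⬝ᵥ w + K ^ 2 * (v ⬝ᵥ v) := by field_simp
  rw [e1, e2] at h'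
  linarith

/-! ### Exact coordinate minimization -/

/-- The gradient `Aᵀ (A x - b)` of the least squares objective. -/
def gradient (A : Matrix (Fin n) (Fin n) ℝ) (b x : Fin n → ℝ) : Fin n → ℝ :=
  Aᵀ *ᵥ (A *ᵥ x - b)

theorem leastSquares_eq (A : Matrix (Fin n) (Fin n) ℝ) (b x : Fin n → ℝ) :
    leastSquares A b x = 1 / 2 * ((A *ᵥ x - b) ⬝ᵥ (A *ᵥ x - b)) := by
  rw [leastSquares, EuclideanSpace.real_norm_sq_eq]
  simp [dotProduct, sq]

theorem leastSquares_nonneg (A : Matrix (Fin n) (Fin n) ℝ) (b x : Fin n → ℝ) :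
    0 ≤ leastSquares A b x := by
  unfold leastSquares
  positivity

theorem minValue_leastSquares {A : Matrix (Fin n) (Fin n) ℝ} {b : Fin n → ℝ}
    (hb : b ∈ Set.range A.mulVec) : minValue (leastSquares A b) = 0 := by
  obtain ⟨z, hz⟩ := hb
  refine le_antisymm ?_ (Real.iInf_nonneg (leastSquares_nonneg A b))
  refine (ciInf_le ⟨0, ?_⟩ z).trans_eq ?_
  · rintro _ ⟨w, rfl⟩
    exact leastSquares_nonneg A b w
  · rw [leastSquares_eq, show A *ᵥ z = b from hz]
    simp

theorem leastSquares_add_single (A : Matrix (Fin n) (Fin n) ℝ) (b y : Fin n → ℝ) (i : Fin n)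
    (t : ℝ) :
    leastSquares A b (y + Pi.single i t) =
      leastSquares A b y + t * gradient A b y i + t ^ 2 / 2 * (Aᵀ * A) i i := by
  have e1 : A *ᵥ (y + Pi.single i t) - b = (A *ᵥ y - b) + A *ᵥ Pi.single i t := by
    rw [mulVec_add]
    abel
  have e2 : (A *ᵥ y - b) ⬝ᵥ (A *ᵥ Pi.single i t) = t * gradient A b y i := by
    rw [gradient, dotProduct_mulVec, ← mulVec_transpose, dotProduct_single, mul_comm]
  have e3 : (A *ᵥ Pi.single i t) ⬝ᵥ (A *ᵥ Pi.single i t) = t ^ 2 * (Aᵀ * A) i i := by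
    rw [← quadratic_gram]
    simp
    ring
  rw [leastSquares_eq, leastSquares_eq, e1]
  simp only [add_dotProduct, dotProduct_add]
  rw [dotProduct_comm (A *ᵥ Pi.single i t) (A *ᵥ y - b), e2, e3]
  ring

theorem gradient_add_single (A : Matrix (Fin n) (Fin n) ℝ) (b y : Fin n → ℝ) (i j : Fin n)
    (t : ℝ) :
    gradient A b (y + Pi.single i t) j = gradient A b y j + (Aᵀ * A) j i * t := by
  have e1 : A *ᵥ (y + Pi.single i t) - b = (A *ᵥ y - b) + A *ᵥ Pi.single i t := by
    rw [mulVec_add]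
    abel
  rw [gradient, e1, mulVec_add, mulVec_mulVec, Pi.add_apply, gradient]
  simp

theorem CoordStep.exists_eq_add_single {A : Matrix (Fin n) (Fin n) ℝ} {b x y : Fin n → ℝ}
    {i : Fin n} (h : CoordStep (leastSquares A b) i x y) :
    ∃ t, x = y + Pi.single i t ∧ gradient A b y i = 0 := by
  obtain ⟨s, rfl, hmin⟩ := h
  set y := Function.update x i s with hy
  have hupd : ∀ t, Function.update x i (s + t) = y + Pi.single i t := by
    intro t
    ext j
    rcases eq_or_ne j i with rfl | hj
    · simp [hy]
    · simp [hy, hj]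
  refine ⟨x i - s, ?_, ?_⟩
  · rw [← hupd]
    simp
  · have hle : ∀ t : ℝ, 0 ≤ t * gradient A b y i + t ^ 2 / 2 * (Aᵀ * A) i i := by
      intro t
      have := hmin (s + t)
      rw [hupd, leastSquares_add_single] at this
      linarith
    have h0 : 0 ≤ (Aᵀ * A) i i := (posSemidef_gram A).diag_nonneg
    -- A step of length `1 / (Q i i + 1)` along the gradient would decrease the objective.
    have := hle (-gradient A b y i / ((Aᵀ * A) i i + 1))
    set g := gradient A b y i
    set q := (Aᵀ * A) i i
    have hq : 0 < q + 1 := by linarith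
    have e : -g / (q + 1) * g + (-g / (q + 1)) ^ 2 / 2 * q =
        -(g ^ 2 * ((q + 2) / (2 * (q + 1) ^ 2))) := by
      field_simp
      ring
    rw [e] at this
    have hc : 0 < (q + 2) / (2 * (q + 1) ^ 2) := by positivity
    have hg : g ^ 2 ≤ 0 := by
      by_contra! hg
      have := mul_pos hg hc
      linarith
    exact pow_eq_zero_iff two_ne_zero |>.mp (le_antisymm hg (sq_nonneg g))

theorem CoordStep.self {f : (Fin n → ℝ) → ℝ} {i : Fin n} {x y : Fin n → ℝ}
    (h : CoordStep f i x y) : CoordStep f i y y := by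
  obtain ⟨s, rfl, hmin⟩ := h
  refine ⟨s, by simp, fun t => ?_⟩
  simpa using hmin t

/-- A sequence of exact coordinate minimizations over distinct coordinates, listed increasingly
for `r`, solves the triangular system `Γ (x - y) = ∇ f x` in the listed rows. The objective
decreases by half the sum of the `Q i i * (x i - y i) ^ 2`. -/
theorem coordSteps_spec {A : Matrix (Fin n) (Fin n) ℝ} {b : Fin n → ℝ} {r : Fin n → Fin n → Prop}
    [DecidableRel r] (hr : ∀ i j, r i j → ¬ r j i) {l : List (Fin n)} (hl : l.Pairwise r)
    {x y : Fin n → ℝ} (h : CoordSteps (leastSquares A b) l x y) :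
    (∀ i, i ∉ l → x i - y i = 0) ∧
    (∀ i ∈ l, (triPart (Aᵀ * A) r *ᵥ (x - y)) i = gradient A b x i) ∧
    leastSquares A b x - leastSquares A b y = 1 / 2 * ∑ i, (Aᵀ * A) i i * (x i - y i) ^ 2 := by
  induction l generalizing x with
  | nil =>
    obtain rfl : y = x := h
    simp
  | cons i l ih =>
    obtain ⟨z, hz, hzy⟩ := h
    obtain ⟨hil, hl⟩ := List.pairwise_cons.mp hl
    obtain ⟨h1, h2, h3⟩ := ih hl hzy
    obtain ⟨t, rfl, hg⟩ := hz.exists_eq_add_single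
    have hi : i ∉ l := fun hi => hr i i (hil i hi) (hil i hi)
    have hsub : z + Pi.single i t - y = (z - y) + Pi.single i t := by abel
    refine ⟨fun j hj => ?_, fun j hj => ?_, ?_⟩
    · simp only [List.mem_cons, not_or] at hj
      simp [hj.1, h1 j hj.2]
    · rw [hsub, mulVec_add, Pi.add_apply, gradient_add_single]
      rcases List.mem_cons.mp hj with rfl | hj
      · have e : (triPart (Aᵀ * A) r *ᵥ (z - y)) j = 0 := by
          change ∑ k, triPart (Aᵀ * A) r j k * (z - y) k = 0
          refine Finset.sum_eq_zero fun k _ => ?_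
          simp only [triPart, of_apply, Pi.sub_apply]
          by_cases hk : k ∈ l
          · rw [if_neg, zero_mul]
            rintro (rfl | hkj)
            · exact hi hk
            · exact hr _ _ hkj (hil k hk)
          · rw [h1 k hk, mul_zero]
        rw [e, hg]
        simp [triPart]
      · rw [h2 j hj]
        simp [triPart, hil j hj]
    · rw [leastSquares_add_single, hg]
      have e : ∑ j, (Aᵀ * A) j j * ((z + Pi.single i t : Fin n → ℝ) j - y j) ^ 2 =
          ∑ j, (Aᵀ * A) j j * (z j - y j) ^ 2 + (Aᵀ * A) i i * t ^ 2 := by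
        have : (Aᵀ * A) i i * t ^ 2 = ∑ j, if j = i then (Aᵀ * A) j j * t ^ 2 else 0 := by simp
        rw [this, ← Finset.sum_add_distrib]
        refine Finset.sum_congr rfl fun j _ => ?_
        rcases eq_or_ne j i with rfl | hj
        · have := h1 j hi
          simp only [Pi.add_apply, Pi.single_eq_same, if_true]
          rw [show z j + t - y j = (z j - y j) + t by ring, this]
          ring
        · simp [hj]
      rw [e]
      linarith

/-! ### Passes over all coordinates -/

/-- One pass over all coordinates, in increasing or decreasing order, contracts the objective
by `rate`. -/
theorem coordSteps_contract (hn : 1 ≤ n) {A : Matrix (Fin n) (Fin n) ℝ} {b : Fin n → ℝ}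
    (hb : b ∈ Set.range A.mulVec) (hdiag : ∀ i, (Aᵀ * A) i i ≠ 0) {r : Fin n → Fin n → Prop}
    [DecidableRel r] (hr : (∀ i j, r i j ↔ i < j) ∨ (∀ i j, r i j ↔ j < i)) {l : List (Fin n)}
    (hl : l.Pairwise r) (hmem : ∀ i, i ∈ l) {x y : Fin n → ℝ}
    (h : CoordSteps (leastSquares A b) l x y) :
    leastSquares A b y ≤ rate (Aᵀ * A) * leastSquares A b x := by
  have hasymm : ∀ i j, r i j → ¬ r j i := by
    intro i j
    rcases hr with hr | hr <;> rw [hr, hr] <;> exact lt_asymm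
  obtain ⟨-, h2, h3⟩ := coordSteps_spec hasymm hl h
  have hn0 : 0 < n := hn
  have hn' : (0 : ℝ) < n := by exact_mod_cast hn0
  have hpos : ∀ i, 0 < (Aᵀ * A) i i := fun i =>
    lt_of_le_of_ne (posSemidef_gram A).diag_nonneg (hdiag i).symm
  have h0 : Aᵀ * A ≠ 0 := fun h => hdiag ⟨0, hn0⟩ (by rw [h]; rfl)
  have hmu := lamMin_pos (posSemidef_gram A) h0
  have hL := lamMax_pos (posSemidef_gram A) h0
  have hne : Nonempty (Fin n) := ⟨⟨0, hn0⟩⟩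
  have htr : 0 < ∑ i, (Aᵀ * A) i i := Finset.sum_pos (fun i _ => hpos i) Finset.univ_nonempty
  have hlog : 0 ≤ Real.log n / Real.pi := div_nonneg (Real.log_natCast_nonneg n) Real.pi_pos.le
  have hmin : ∀ i, diagMin (Aᵀ * A) ≤ (Aᵀ * A) i i := fun i =>
    ciInf_le (Set.finite_range _).bddBelow i
  have hmin0 : 0 ≤ diagMin (Aᵀ * A) := le_ciInf fun i => (hpos i).le
  have hΓ : triPart (Aᵀ * A) r *ᵥ (x - y) = gradient A b x := funext fun i => h2 i (hmem i)
  have hdec : diagMin (Aᵀ * A) / 2 * ((x - y) ⬝ᵥ (x - y)) ≤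
      leastSquares A b x - leastSquares A b y := by
    rw [h3]
    simp only [dotProduct, Finset.mul_sum, Pi.sub_apply]
    refine Finset.sum_le_sum fun i _ => ?_
    have := mul_le_mul_of_nonneg_right (hmin i) (sq_nonneg (x i - y i))
    linarith
  have hPL : 2 * lamMin (Aᵀ * A) * leastSquares A b x ≤ gradient A b x ⬝ᵥ gradient A b x := by
    obtain ⟨z, hz⟩ := hb
    have e : A *ᵥ x - b = A *ᵥ (x - z) := by rw [mulVec_sub, show A *ᵥ z = b from hz]
    rw [leastSquares_eq, gradient, e, mulVec_mulVec, ← quadratic_gram]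
    have := lamMin_mul_quadratic_le (posSemidef_gram A) (x - z)
    linarith
  -- A bound `K` on the squared norm of the triangular part gives the factor `1 - μ m / K`.
  have main : ∀ K, 0 < K → (triPart (Aᵀ * A) r *ᵥ (x - y)) ⬝ᵥ (triPart (Aᵀ * A) r *ᵥ (x - y)) ≤
      K * ((x - y) ⬝ᵥ (x - y)) → leastSquares A b y ≤
        (1 - lamMin (Aᵀ * A) * diagMin (Aᵀ * A) / K) * leastSquares A b x := by
    intro K hK hle
    rw [hΓ] at hle
    have h4 : lamMin (Aᵀ * A) * diagMin (Aᵀ * A) / K * leastSquares A b x ≤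
        diagMin (Aᵀ * A) / 2 * ((x - y) ⬝ᵥ (x - y)) := by
      have := mul_le_mul_of_nonneg_left (hPL.trans hle)
        (div_nonneg hmin0 (by positivity : 0 ≤ 2 * K))
      refine le_trans (le_of_eq ?_) (this.trans_eq ?_) <;> field_simp
    linarith
  unfold rate
  rw [min_mul_of_nonneg _ _ (leastSquares_nonneg A b x)]
  refine le_min ?_ ?_
  · refine (main _ (mul_pos hL htr) (triPart_mulVec_sq_le_trace A r (x - y))).trans_eq ?_
    congr 2
    unfold condNumber diagAvg
    field_simp
  · refine (main _ (by positivity) (triPart_mulVec_sq_le_log hn0 A r hr hL (x - y))).trans_eq ?_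
    congr 2
    unfold condNumber
    field_simp

theorem coordSteps_append {f : (Fin n → ℝ) → ℝ} {l₁ l₂ : List (Fin n)} {x y : Fin n → ℝ} :
    CoordSteps f (l₁ ++ l₂) x y ↔ ∃ z, CoordSteps f l₁ x z ∧ CoordSteps f l₂ z y := by
  induction l₁ generalizing x with
  | nil => simp [CoordSteps]
  | cons i l ih =>
    simp only [List.cons_append, CoordSteps, ih]
    constructor
    · rintro ⟨w, hw, z, h1, h2⟩
      exact ⟨z, ⟨w, hw, h1⟩, h2⟩
    · rintro ⟨z, ⟨w, hw, h1⟩, h2⟩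
      exact ⟨w, hw, z, h1, h2⟩

/-- After a forward pass the last coordinate is already optimal, so the backward pass amounts to
one over all coordinates. -/
theorem BackwardPass.coordSteps_reverse {f : (Fin n → ℝ) → ℝ} {x y z : Fin n → ℝ}
    (h : ForwardPass f x y) (h' : BackwardPass f y z) :
    CoordSteps f (List.finRange n).reverse y z := by
  unfold ForwardPass at h
  unfold BackwardPass at h'
  rcases List.eq_nil_or_concat (List.finRange n) with e | ⟨l, i, e⟩
  · rw [e] at h' ⊢
    exact h'
  · rw [e] at h h' ⊢
    rw [List.concat_eq_append] at *
    obtain ⟨w, -, v, hv, hvy⟩ := coordSteps_append.mp h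
    obtain rfl : y = v := hvy
    simp only [List.reverse_append, List.reverse_cons, List.reverse_nil, List.nil_append,
      List.singleton_append, List.tail_cons] at h' ⊢
    exact ⟨y, hv.self, h'⟩

end SGSCD

theorem mainTheorem3 (n : ℕ) (hn : 1 ≤ n) (A : Matrix (Fin n) (Fin n) ℝ) (b : Fin n → ℝ)
    (hb : b ∈ Set.range A.mulVec) (hdiag : ∀ i, (A.transpose * A) i i ≠ 0)
    (x xhalf : ℕ → Fin n → ℝ) (hx : SGSCD.IsSGSCD (SGSCD.leastSquares A b) x xhalf) (k : ℕ) :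
    (SGSCD.leastSquares A b (xhalf k) - SGSCD.minValue (SGSCD.leastSquares A b) ≤
      SGSCD.rate (A.transpose * A) *
        (SGSCD.leastSquares A b (x k) - SGSCD.minValue (SGSCD.leastSquares A b))) ∧
    (SGSCD.leastSquares A b (x (k + 1)) - SGSCD.minValue (SGSCD.leastSquares A b) ≤
      SGSCD.rate (A.transpose * A) *
        (SGSCD.leastSquares A b (xhalf k) - SGSCD.minValue (SGSCD.leastSquares A b))) ∧
    (SGSCD.leastSquares A b (x (k + 1)) - SGSCD.minValue (SGSCD.leastSquares A b) ≤
      SGSCD.rate (A.transpose * A) ^ 2 *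
        (SGSCD.leastSquares A b (x k) - SGSCD.minValue (SGSCD.leastSquares A b))) := by
  rw [SGSCD.minValue_leastSquares hb]
  simp only [sub_zero]
  have h1 := SGSCD.coordSteps_contract hn hb hdiag (r := (· < ·)) (Or.inl fun _ _ => Iff.rfl)
    (List.pairwise_lt_finRange n) List.mem_finRange (hx.forward k)
  have h2 := SGSCD.coordSteps_contract hn hb hdiag (r := fun i j => j < i)
    (Or.inr fun _ _ => Iff.rfl) (List.pairwise_reverse.mpr (List.pairwise_lt_finRange n))
    (fun i => List.mem_reverse.mpr (List.mem_finRange i))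
    (SGSCD.BackwardPass.coordSteps_reverse (hx.forward k) (hx.backward k))
  refine ⟨h1, h2, ?_⟩
  have h0 := SGSCD.leastSquares_nonneg A b (x k)
  have hh := SGSCD.leastSquares_nonneg A b (xhalf k)
  rcases h0.eq_or_lt with e | hpos
  · rw [← e, mul_zero] at h1 ⊢
    rw [le_antisymm h1 hh, mul_zero] at h2
    exact h2
  · -- The first estimate bounds a nonnegative number, so the rate is nonnegative.
    have hrate : 0 ≤ SGSCD.rate (A.transpose * A) :=
      nonneg_of_mul_nonneg_left (hh.trans h1) hpos
    calc _ ≤ _ := h2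
      _ ≤ _ := mul_le_mul_of_nonneg_left h1 hrate
      _ = _ := by ring
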